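/- Let $q$ be a prime power, let $m>2$ be an integer, and let $V$ be an $m$-dimensional vector space over $\mathbb F_q$; fix a basis of $V$ and use it to identify $\bigwedge^m V$ with $\mathbb F_q$. Let $A_1\subsetneq A_2$ be nonzero subspaces of $V$, and put $\alpha_i=\dim A_i$ and $\alpha=(\alpha_1,\alpha_2)$. Let $$\Omega_\alpha(2,m)=\{L\subseteq V : \dim L=2,\ \dim(L\cap A_1)\ge 1,\ \dim (L\cap A_2)\ge 2\},$$ let $L_1,\dots,L_n$ be an enumeration of its elements, and for each $j$ let $P_j=v_2\wedge v_1\in\bigwedge^2V$, where $\{v_1,v_2\}$ is a basis of $L_j$ with $v_1\in A_1$ and $v_2\in A_2$. For $f\in\bigwedge^{m-2}V$ let $$c_f=(f\wedge P_1,\dots,f\wedge P_n)\in\mathbb F_q^n .$$ The Schubert code is $C_\alpha(2,m)=\{c_f: f\in\bigwedge^{m-2}V\}$. A minimum weight codeword of it is a codeword whose Hamming weight equals the minimum of the Hamming weights of the nonzero codewords. For $h\in\bigwedge^{m-2}V$ put $V_h=\{x\in V: h\wedge x=0\}$. Call $h$ Schubert decomposable if $h\neq 0$, $h=h_1\wedge\dots\wedge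 h_{m-2}$ for some $h_1,\dots,h_{m-2}\in V$, $\dim(V_h\cap A_2)=\alpha_2-2$, and, in case $\alpha_2-\alpha_1\ge 2$, also $\dim(V_h\cap A_1)=\alpha_1-1$. Then for every $c\in\mathbb F_q^n$: $c$ is a minimum weight codeword of $C_\alpha(2,m)$ if and only if $c=c_h$ for some Schubert decomposable $h\in\bigwedge^{m-2}V$. -/

import Mathlib

namespace SchubertCode

open Module

variable {K : Type*} [Field K] {V : Type*} [AddCommGroup V] [Module K V]

/-- `f ∈ ⋀^d V` is decomposable: `f ≠ 0` and `f = f₁ ∧ ⋯ ∧ f_d` for some `f₁, …, f_d ∈ V`. -/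
def IsDecomposable {d : ℕ} (f : ⋀[K]^d V) : Prop :=
  f ≠ 0 ∧ ∃ v : Fin d → V, f = exteriorPower.ιMulti K d v

/-- The annihilator `V_f = {x ∈ V : f ∧ x = 0}` of `f ∈ ⋀^d V`. -/
def annihilator {d : ℕ} (f : ⋀[K]^d V) : Submodule K V :=
  LinearMap.ker
    ((LinearMap.mulLeft K (f : ExteriorAlgebra K V)).comp (ExteriorAlgebra.ι K))

/-- The Schubert variety of the partial flag `A₁ ⊂ ⋯ ⊂ A_ℓ`: the `ℓ`-dimensional subspaces `L`
with `dim (L ∩ A_i) ≥ i` for all `i` (the member `A_{i+1}` of the flag is `A i`, `i : Fin ℓ`). -/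
def schubertVariety {ℓ : ℕ} (A : Fin ℓ → Submodule K V) : Set (Submodule K V) :=
  {L | finrank K L = ℓ ∧ ∀ i : Fin ℓ, (i : ℕ) + 1 ≤ finrank K ↥(L ⊓ A i)}

/-- `i + 1` is the last position of a block of consecutive entries of the dimension sequence `α`
of the flag, that is, one of `p₁ < ⋯ < p_u < p_{u+1} = ℓ`: either the last position `ℓ`, or a
position after which `α` jumps by at least `2`. -/
def IsBlockEnd {ℓ : ℕ} (A : Fin ℓ → Submodule K V) (i : Fin ℓ) : Prop :=
  (i : ℕ) + 1 = ℓ ∨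
    ∃ h : (i : ℕ) + 1 < ℓ, finrank K (A i) + 2 ≤ finrank K (A ⟨(i : ℕ) + 1, h⟩)

/-- `f` is Schubert decomposable with respect to the flag `A`: it is decomposable and
`dim (V_f ∩ A_p) = α_p - p` for `p = p₁, …, p_{u+1}`. -/
def IsSchubertDecomposable {ℓ d : ℕ} (A : Fin ℓ → Submodule K V) (f : ⋀[K]^d V) : Prop :=
  IsDecomposable f ∧
    ∀ i : Fin ℓ, IsBlockEnd A i →
      finrank K ↥(annihilator f ⊓ A i) + ((i : ℕ) + 1) = finrank K (A i)

/-- `P ∈ ⋀^ℓ V` is an admissible representative of `L`: `P = v_ℓ ∧ ⋯ ∧ v₁` with `v_i ∈ A_i` and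
`v₁, …, v_ℓ` spanning `L` (for `L` of dimension `ℓ`, they are then a basis of `L`). -/
def IsRepresentative {ℓ : ℕ} (A : Fin ℓ → Submodule K V) (L : Submodule K V)
    (P : ⋀[K]^ℓ V) : Prop :=
  ∃ v : Fin ℓ → V, (∀ i, v i ∈ A i) ∧ Submodule.span K (Set.range v) = L ∧
    P = exteriorPower.ιMulti K ℓ (fun i => v i.rev)

/-- The wedge product `⋀^{m-ℓ} V → ⋀^m V`, `f ↦ f ∧ P`, for `P ∈ ⋀^ℓ V`. -/
def wedgeTop {ℓ m : ℕ} (hℓ : ℓ ≤ m) (P : ⋀[K]^ℓ V) : ⋀[K]^(m - ℓ) V →ₗ[K] ⋀[K]^m V :=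
  ((LinearMap.mulRight K (P : ExteriorAlgebra K V)).comp (⋀[K]^(m - ℓ) V).subtype).codRestrict
    (⋀[K]^m V) (fun f => by
      have h := SetLike.mul_mem_graded (A := fun i : ℕ => ⋀[K]^i V) f.2 P.2
      rwa [Nat.sub_add_cancel hℓ] at h)

/-- The identification of `⋀^m V` with the field given by a basis `b` of `V`, which sends
`b₁ ∧ ⋯ ∧ b_m` to `1`. -/
noncomputable def topScalar {m : ℕ} (b : Basis (Fin m) K V) : ⋀[K]^m V →ₗ[K] K :=
  exteriorPower.alternatingMapLinearEquiv b.det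

/-- The evaluation map `f ↦ c_f = (f ∧ P₁, …, f ∧ P_n)`. -/
noncomputable def codeword {ℓ m n : ℕ} (hℓ : ℓ ≤ m) (b : Basis (Fin m) K V)
    (P : Fin n → ⋀[K]^ℓ V) : ⋀[K]^(m - ℓ) V →ₗ[K] (Fin n → K) :=
  LinearMap.pi fun j => (topScalar b).comp (wedgeTop hℓ (P j))

/-- The code attached to representatives `P₁, …, P_n`: the image of the evaluation map. -/
noncomputable def code {ℓ m n : ℕ} (hℓ : ℓ ≤ m) (b : Basis (Fin m) K V)
    (P : Fin n → ⋀[K]^ℓ V) : Submodule K (Fin n → K) :=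
  LinearMap.range (codeword hℓ b P)

/-- `c` is a minimum weight codeword of the linear code `C`: it is a codeword whose Hamming weight
is the minimum of the weights of the nonzero codewords. -/
def IsMinWeightCodeword [DecidableEq K] {n : ℕ} (C : Submodule K (Fin n → K))
    (c : Fin n → K) : Prop :=
  c ∈ C ∧ IsLeast {w : ℕ | ∃ x ∈ C, x ≠ 0 ∧ hammingNorm x = w} (hammingNorm c)

end SchubertCode

namespace SchubertCode

open Module

/-! ### The alternating form of an element of ⋀^{m-2} V -/

section Form

variable {K : Type*} [Field K] {V : Type*} [AddCommGroup V] [Module K V]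

/-! An element f enters its codeword only through the alternating form B(x, y) = f ∧ x ∧ y, and only
through the values of B on A₁ × A₂. The weight is the number of planes L of the Schubert variety on
which B is nonzero, and these are counted by pairs: a pair (x, y) ∈ A₁ × A₂ with B(x, y) ≠ 0 spans
exactly one such L. An L outside A₁ receives (q-1)(q²-q) pairs; an L inside A₁ receives q+1 times as
many, all of them in A₁ × A₁. Hence, with N the number of non-orthogonal pairs, (q+1) N(A₁, A₂) - q
N(A₁, A₁) = (q²-1)(q²-q) · weight (`hammingNorm_eq_pairCount`).

By `card_mul_pairCount`, N depends on B only through the dimension of a radical, so the weight is a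
function of k and t, the dimensions of the radicals of A₁ against A₂ and against itself. By
`weight_bound` a nonzero B on A₁ × A₂ has weight at least q^(α₁+α₂-3), with equality exactly when k
= α₁-1, or α₂ = α₁+1 and k = t = α₁-2.

The form of a decomposable element is a wedge φ ∧ ψ of two functionals, and Schubert decomposability
gives it such radicals. Conversely, for such radicals there are x₀ ∈ A₁, y₀ ∈ A₂ with B(x₀, y₀) = 1
and A₁ contained in the radical plus ⟨x₀, y₀⟩. Then B agrees on A₁ × A₂ with the wedge of B(·, y₀)
and B(x₀, ·), which is the form of a Schubert decomposable h. So c_f = c_h, although f and h may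
differ. -/

theorem coe_wedgeTop_apply {ℓ m : ℕ} (hℓ : ℓ ≤ m) (P : ⋀[K]^ℓ V) (f : ⋀[K]^(m - ℓ) V) :
    (wedgeTop hℓ P f : ExteriorAlgebra K V) = (f : ExteriorAlgebra K V) * P := rfl

theorem coe_ιMulti_two (v : Fin 2 → V) :
    (exteriorPower.ιMulti K 2 v : ExteriorAlgebra K V) =
      ExteriorAlgebra.ι K (v 0) * ExteriorAlgebra.ι K (v 1) := by
  simp [ExteriorAlgebra.ιMulti_apply, Matrix.vecTail]

theorem coe_ιMulti_snoc {k : ℕ} (v : Fin k → V) (x : V) :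
    (exteriorPower.ιMulti K (k + 1) (Fin.snoc v x : Fin (k + 1) → V) : ExteriorAlgebra K V) =
      (exteriorPower.ιMulti K k v : ExteriorAlgebra K V) * ExteriorAlgebra.ι K x := by
  rw [exteriorPower.ιMulti_apply_coe, exteriorPower.ιMulti_apply_coe,
    ExteriorAlgebra.ιMulti_apply, ExteriorAlgebra.ιMulti_apply, List.ofFn_succ']
  simp

/-- The alternating bilinear form `(x, y) ↦ f ∧ x ∧ y` attached to `f ∈ ⋀^{m-2} V`. -/
noncomputable def wedgeForm {m : ℕ} (hm : 2 ≤ m) (b : Basis (Fin m) K V) (f : ⋀[K]^(m - 2) V) :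
    V →ₗ[K] V →ₗ[K] K :=
  LinearMap.mk₂ K (fun x y => topScalar b (wedgeTop hm (exteriorPower.ιMulti K 2 ![x, y]) f))
    (fun x x' y => by
      rw [← map_add]; congr 1; ext
      simp only [coe_wedgeTop_apply, coe_ιMulti_two, Submodule.coe_add]
      simp [mul_add, add_mul])
    (fun c x y => by
      rw [← map_smul]; congr 1; ext
      simp only [coe_wedgeTop_apply, coe_ιMulti_two, Submodule.coe_smul]
      simp)
    (fun x y y' => by
      rw [← map_add]; congr 1; ext
      simp only [coe_wedgeTop_apply, coe_ιMulti_two, Submodule.coe_add]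
      simp [mul_add])
    (fun c x y => by
      rw [← map_smul]; congr 1; ext
      simp only [coe_wedgeTop_apply, coe_ιMulti_two, Submodule.coe_smul]
      simp)

variable {m : ℕ} (hm : 2 ≤ m) (b : Basis (Fin m) K V)

theorem wedgeForm_apply (f : ⋀[K]^(m - 2) V) (x y : V) :
    wedgeForm hm b f x y = topScalar b (wedgeTop hm (exteriorPower.ιMulti K 2 ![x, y]) f) := rfl

theorem wedgeForm_self (f : ⋀[K]^(m - 2) V) (x : V) : wedgeForm hm b f x x = 0 := by
  have : wedgeTop hm (exteriorPower.ιMulti K 2 ![x, x]) f = 0 := by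
    ext; simp [coe_wedgeTop_apply]
  rw [wedgeForm_apply, this, map_zero]

theorem wedgeForm_eq_zero_of_mem_annihilator {f : ⋀[K]^(m - 2) V} {x : V}
    (hx : x ∈ annihilator f) (y : V) : wedgeForm hm b f x y = 0 := by
  have hx' : (f : ExteriorAlgebra K V) * ExteriorAlgebra.ι K x = 0 := hx
  have : wedgeTop hm (exteriorPower.ιMulti K 2 ![x, y]) f = 0 := by
    ext; simp [coe_wedgeTop_apply, ← mul_assoc, hx']
  rw [wedgeForm_apply, this, map_zero]

theorem codeword_apply {n : ℕ} (P : Fin n → ⋀[K]^2 V) (f : ⋀[K]^(m - 2) V) (j : Fin n)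
    (v : Fin 2 → V) (hv : P j = exteriorPower.ιMulti K 2 (fun i => v i.rev)) :
    codeword hm b P f j = wedgeForm hm b f (v 1) (v 0) := by
  have : (fun i : Fin 2 => v i.rev) = ![v 1, v 0] := by
    ext i; fin_cases i <;> rfl
  rw [wedgeForm_apply, ← this, ← hv]; rfl

/-- Representatives are wedges of a vector of `A 1` with a vector of `A 0`, so nothing else of the
form is visible to the code. -/
theorem codeword_congr {n : ℕ} {A : Fin 2 → Submodule K V} {P : Fin n → ⋀[K]^2 V}
    {L : Fin n → Submodule K V} (hP : ∀ j, IsRepresentative A (L j) (P j))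
    {f g : ⋀[K]^(m - 2) V}
    (h : ∀ x ∈ A 0, ∀ y ∈ A 1, wedgeForm hm b f y x = wedgeForm hm b g y x) :
    codeword hm b P f = codeword hm b P g := by
  ext j
  obtain ⟨v, hv, -, hvP⟩ := hP j
  rw [codeword_apply hm b P f j v hvP, codeword_apply hm b P g j v hvP]
  exact h _ (hv 0) _ (hv 1)

/-- The value is the determinant of m independent vectors, which form a basis of V. -/
theorem wedgeForm_ιMulti_ne_zero {v : Fin (m - 2) → V} {x y : V}
    (h : LinearIndependent K
      (Fin.snoc (Fin.snoc v x : Fin (m - 2 + 1) → V) y : Fin (m - 2 + 1 + 1) → V)) :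
    wedgeForm hm b (exteriorPower.ιMulti K (m - 2) v) x y ≠ 0 := by
  obtain ⟨k, rfl⟩ : ∃ k, m = k + 2 := ⟨m - 2, by omega⟩
  have e : wedgeTop hm (exteriorPower.ιMulti K 2 ![x, y]) (exteriorPower.ιMulti K (k + 2 - 2) v) =
      exteriorPower.ιMulti K (k + 2) (Fin.snoc (Fin.snoc v x : Fin (k + 1) → V) y) := by
    ext
    rw [coe_ιMulti_snoc, coe_ιMulti_snoc, coe_wedgeTop_apply, coe_ιMulti_two, mul_assoc]
    rfl
  rw [wedgeForm_apply, e, topScalar, exteriorPower.alternatingMapLinearEquiv_apply_ιMulti]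
  have := Module.Finite.of_basis b
  have hs : Submodule.span K (Set.range (Fin.snoc (Fin.snoc v x : Fin (k + 1) → V) y :
      Fin (k + 2) → V)) = ⊤ :=
    h.span_eq_top_of_card_eq_finrank' (by rw [finrank_eq_card_basis b]; rfl)
  exact ((b.is_basis_iff_det).1 ⟨h, hs⟩).ne_zero

theorem mem_annihilator_ιMulti {k : ℕ} (v : Fin k → V) (i : Fin k) :
    v i ∈ annihilator (exteriorPower.ιMulti K k v) := by
  change (exteriorPower.ιMulti K k v : ExteriorAlgebra K V) * ExteriorAlgebra.ι K (v i) = 0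
  rw [← coe_ιMulti_snoc, AlternatingMap.map_eq_zero_of_eq _ _
    (i := i.castSucc) (j := Fin.last k) (by simp) (Fin.castSucc_lt_last i).ne]
  rfl

theorem span_le_annihilator_ιMulti {k : ℕ} (v : Fin k → V) :
    Submodule.span K (Set.range v) ≤ annihilator (exteriorPower.ιMulti K k v) := by
  rw [Submodule.span_le]
  rintro _ ⟨i, rfl⟩
  exact mem_annihilator_ιMulti v i

end Form

/-! ### Identities for alternating forms -/

section Bilinear

variable {K : Type*} [Field K] {V : Type*} [AddCommGroup V] [Module K V]
  {B : V →ₗ[K] V →ₗ[K] K}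

theorem neg_of_self_eq_zero (hB : ∀ x, B x x = 0) (x y : V) : B y x = -B x y := by
  have := hB (x + y)
  simp only [map_add, LinearMap.add_apply, hB, zero_add, add_zero] at this
  exact eq_neg_of_add_eq_zero_left this

/-- If `x` lies in `W + ⟨x₀, y₀⟩`, `W` is orthogonal to `y` and to `x₀`, `y₀`, and
`B(x₀, y₀) = 1`, then `B` agrees at `(x, y)` with the wedge of the functionals `B(·, y₀)` and
`B(x₀, ·)`. -/
theorem apply_eq_of_mem_sup (hB : ∀ x, B x x = 0) {W : Submodule K V} {x₀ y₀ x y : V}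
    (h1 : B x₀ y₀ = 1) (hW : ∀ w ∈ W, B w x₀ = 0 ∧ B w y₀ = 0 ∧ B w y = 0)
    (hx : x ∈ W ⊔ Submodule.span K {x₀, y₀}) :
    B x y = B x y₀ * B x₀ y - B y y₀ * B x₀ x := by
  obtain ⟨w, hw, z, hz, rfl⟩ := Submodule.mem_sup.1 hx
  obtain ⟨r, s, rfl⟩ := Submodule.mem_span_pair.1 hz
  obtain ⟨e1, e2, e3⟩ := hW w hw
  have e4 : B x₀ w = 0 := by rw [neg_of_self_eq_zero hB w x₀, e1, neg_zero]
  simp only [map_add, map_smul, LinearMap.add_apply, LinearMap.smul_apply, smul_eq_mul, e2, e3, e4,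
    hB, h1, neg_of_self_eq_zero hB y₀ y]
  ring

end Bilinear

/-! ### Decomposable elements and wedges of two functionals -/

section Decomposable

variable {K : Type*} [Field K] {V : Type*} [AddCommGroup V] [Module K V]
  {m : ℕ} (hm : 2 ≤ m) (b : Basis (Fin m) K V)

theorem sup_span_pair_eq_top (b : Basis (Fin m) K V) {v : Fin (m - 2) → V} {x y : V} (hm : 2 ≤ m)
    (h : LinearIndependent K
      (Fin.snoc (Fin.snoc v x : Fin (m - 2 + 1) → V) y : Fin (m - 2 + 1 + 1) → V)) :
    Submodule.span K (Set.range v) ⊔ Submodule.span K {x, y} = ⊤ := by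
  have := Module.Finite.of_basis b
  have := h.span_eq_top_of_card_eq_finrank' (by
    rw [finrank_eq_card_basis b, Fintype.card_fin, Fintype.card_fin]; omega)
  rw [Fin.range_snoc, Fin.range_snoc] at this
  rw [← this, ← Submodule.span_union]
  congr 1
  ext z; simp only [Set.mem_union, Set.mem_insert_iff, Set.mem_singleton_iff]; tauto

/-- The form attached to a decomposable element has rank two, and its radical is the
annihilator. -/
theorem IsDecomposable.exists_wedgeForm_eq {h : ⋀[K]^(m - 2) V} (hh : IsDecomposable h) :
    ∃ x₀ y₀ : V, wedgeForm hm b h x₀ y₀ = 1 ∧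
      (∀ x, x ∈ annihilator h ↔ wedgeForm hm b h x y₀ = 0 ∧ wedgeForm hm b h x₀ x = 0) ∧
      ∀ x y, wedgeForm hm b h x y =
        wedgeForm hm b h x y₀ * wedgeForm hm b h x₀ y -
          wedgeForm hm b h y y₀ * wedgeForm hm b h x₀ x := by
  obtain ⟨h0, v, rfl⟩ := hh
  have := Module.Finite.of_basis b
  have hv : LinearIndependent K v := by
    by_contra hv
    exact h0 (AlternatingMap.map_linearDependent _ v hv)
  have key : ∀ {k : ℕ} {u : Fin k → V}, LinearIndependent K u → k < m →
      ∃ x, LinearIndependent K (Fin.snoc u x : Fin (k + 1) → V) := by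
    intro k u hu hk
    have : Submodule.span K (Set.range u) ≠ ⊤ := by
      intro ht
      have := finrank_span_eq_card hu
      rw [ht, finrank_top, finrank_eq_card_basis b] at this
      simp at this; omega
    obtain ⟨x, hx⟩ := SetLike.exists_not_mem_of_ne_top _ this
    exact ⟨x, linearIndependent_finSnoc.2 ⟨hu, hx⟩⟩
  obtain ⟨x₀, hx₀⟩ := key hv (by omega)
  obtain ⟨y₁, hy₁⟩ := key hx₀ (by omega)
  have hne := wedgeForm_ιMulti_ne_zero hm b hy₁
  set B := wedgeForm hm b (exteriorPower.ιMulti K (m - 2) v) with hBdef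
  have hB : ∀ x, B x x = 0 := wedgeForm_self hm b _
  have hrad : ∀ w ∈ Submodule.span K (Set.range v), ∀ y, B w y = 0 := fun w hw y =>
    wedgeForm_eq_zero_of_mem_annihilator hm b (span_le_annihilator_ιMulti v hw) y
  have htop := sup_span_pair_eq_top b hm hy₁
  -- Rescaling the last basis vector makes (x₀, y₀) a hyperbolic pair; it still complements the span
  -- of `v`.
  set y₀ := (B x₀ y₁)⁻¹ • y₁ with hy₀
  have h1 : B x₀ y₀ = 1 := by simp [hy₀, inv_mul_cancel₀ hne]
  have hpair : Submodule.span K {x₀, y₁} ≤ Submodule.span K {x₀, y₀} := by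
    rw [Submodule.span_le]
    rintro z (hz | hz)
    · exact Submodule.subset_span (Or.inl hz)
    · have : z = (B x₀ y₁) • y₀ := by
        rw [hy₀, smul_smul, mul_inv_cancel₀ hne, one_smul]; exact hz
      rw [this]
      exact Submodule.smul_mem _ _ (Submodule.subset_span (by simp))
  have htop' : Submodule.span K (Set.range v) ⊔ Submodule.span K {x₀, y₀} = ⊤ :=
    top_le_iff.1 (htop ▸ sup_le_sup_left hpair _)
  refine ⟨x₀, y₀, h1, fun x => ⟨fun hx => ⟨?_, ?_⟩, ?_⟩, fun x y => ?_⟩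
  · exact wedgeForm_eq_zero_of_mem_annihilator hm b hx y₀
  · rw [neg_of_self_eq_zero hB x x₀, neg_eq_zero]
    exact wedgeForm_eq_zero_of_mem_annihilator hm b hx x₀
  · rintro ⟨e1, e2⟩
    have hx : x ∈ Submodule.span K (Set.range v) ⊔ Submodule.span K {x₀, y₀} := htop' ▸ trivial
    obtain ⟨w, hw, z, hz, rfl⟩ := Submodule.mem_sup.1 hx
    obtain ⟨r, s, rfl⟩ := Submodule.mem_span_pair.1 hz
    have e4 : B x₀ w = 0 := by rw [neg_of_self_eq_zero hB w x₀, hrad w hw, neg_zero]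
    simp only [map_add, map_smul, LinearMap.add_apply, LinearMap.smul_apply, smul_eq_mul,
      hrad w hw, e4, hB, h1, mul_one, mul_zero, zero_add, add_zero] at e1 e2
    subst e1 e2
    simpa using span_le_annihilator_ιMulti v hw
  · exact apply_eq_of_mem_sup hB h1 (fun w hw => ⟨hrad w hw _, hrad w hw _, hrad w hw _⟩)
      (htop' ▸ trivial)

/-- Every wedge of two independent functionals is the form attached to a decomposable element. -/
theorem exists_isDecomposable_wedgeForm_eq (hm : 2 < m) {φ ψ : V →ₗ[K] K} {x₀ y₀ : V}
    (hφx : φ x₀ = 1) (hφy : φ y₀ = 0) (hψx : ψ x₀ = 0) (hψy : ψ y₀ = 1) :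
    ∃ h : ⋀[K]^(m - 2) V, IsDecomposable h ∧
      annihilator h = LinearMap.ker φ ⊓ LinearMap.ker ψ ∧
      ∀ x y, wedgeForm hm.le b h x y = φ x * ψ y - φ y * ψ x := by
  have := Module.Finite.of_basis b
  set W := LinearMap.ker φ ⊓ LinearMap.ker ψ with hW
  have hker : LinearMap.ker (φ.prod ψ) = W := LinearMap.ker_prod φ ψ
  have hrange : LinearMap.range (φ.prod ψ) = ⊤ := by
    rw [LinearMap.range_eq_top]
    rintro ⟨r, s⟩
    exact ⟨r • x₀ + s • y₀, by simp [hφx, hφy, hψx, hψy]⟩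
  have hdim : finrank K W = m - 2 := by
    have := LinearMap.finrank_range_add_finrank_ker (φ.prod ψ)
    rw [hker, hrange, finrank_top, finrank_eq_card_basis b, Fintype.card_fin] at this
    simp at this; omega
  let w : Basis (Fin (m - 2)) K W := finBasisOfFinrankEq K W hdim
  let v : Fin (m - 2) → V := fun i => (w i : V)
  have hspan : Submodule.span K (Set.range v) = W := by
    have : Set.range v = W.subtype '' Set.range w := by rw [← Set.range_comp]; rfl
    rw [this, ← Submodule.map_span, w.span_eq, Submodule.map_top, Submodule.range_subtype]
  have hli : LinearIndependent K
      (Fin.snoc (Fin.snoc v x₀ : Fin (m - 2 + 1) → V) y₀ : Fin (m - 2 + 1 + 1) → V) := by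
    refine linearIndependent_finSnoc.2 ⟨linearIndependent_finSnoc.2
      ⟨w.linearIndependent.map' W.subtype (Submodule.ker_subtype W), ?_⟩, ?_⟩
    · rw [hspan]; intro hx
      have : φ x₀ = 0 := hx.1
      rw [hφx] at this; exact one_ne_zero this
    · have hle : Submodule.span K (Set.range (Fin.snoc v x₀ : Fin (m - 2 + 1) → V)) ≤
          LinearMap.ker ψ := by
        rw [Fin.range_snoc, Submodule.span_le]
        rintro z (rfl | ⟨i, rfl⟩)
        · exact hψx
        · exact (w i).2.2
      intro hy
      have : ψ y₀ = 0 := hle hy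
      rw [hψy] at this; exact one_ne_zero this
  have hne := wedgeForm_ιMulti_ne_zero hm.le b hli
  set c := wedgeForm hm.le b (exteriorPower.ιMulti K (m - 2) v) x₀ y₀ with hc
  -- The scalar normalising the form is absorbed into one factor, so that the multiple is again a
  -- wedge of vectors; m > 2 provides a factor.
  let i₀ : Fin (m - 2) := ⟨0, by omega⟩
  have hsm : exteriorPower.ιMulti K (m - 2) (Function.update v i₀ (c⁻¹ • v i₀)) =
      c⁻¹ • exteriorPower.ιMulti K (m - 2) v := by
    rw [AlternatingMap.map_update_smul, Function.update_eq_self]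
  set h := c⁻¹ • exteriorPower.ιMulti K (m - 2) v with hh
  have hform : ∀ x y, wedgeForm hm.le b h x y =
      c⁻¹ * wedgeForm hm.le b (exteriorPower.ιMulti K (m - 2) v) x y := by
    intro x y
    rw [wedgeForm_apply, wedgeForm_apply, hh, map_smul, map_smul, smul_eq_mul]
  have h1 : wedgeForm hm.le b h x₀ y₀ = 1 := by rw [hform, ← hc, inv_mul_cancel₀ hne]
  have hWann : W ≤ annihilator h := by
    rw [← hspan]
    intro x hx
    have hx' : (exteriorPower.ιMulti K (m - 2) v : ExteriorAlgebra K V) * ExteriorAlgebra.ι K x = 0 :=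
      span_le_annihilator_ιMulti v hx
    change (h : ExteriorAlgebra K V) * ExteriorAlgebra.ι K x = 0
    rw [hh, Submodule.coe_smul, smul_mul_assoc, hx', smul_zero]
  have hrad : ∀ x ∈ W, ∀ y, wedgeForm hm.le b h x y = 0 := fun x hx y =>
    wedgeForm_eq_zero_of_mem_annihilator hm.le b (hWann hx) y
  have hB := wedgeForm_self hm.le b h
  -- Modulo the radical W each x is φ(x) x₀ + ψ(x) y₀, so the form is determined by its value 1 at
  -- (x₀, y₀).
  have hsub : ∀ x, x - (φ x • x₀ + ψ x • y₀) ∈ W := fun x => by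
    simp [hW, hφx, hφy, hψx, hψy]
  have hdec : ∀ x y, wedgeForm hm.le b h x y =
      φ x * wedgeForm hm.le b h x₀ y + ψ x * wedgeForm hm.le b h y₀ y := by
    intro x y
    have := hrad _ (hsub x) y
    simp only [map_sub, map_add, map_smul, LinearMap.sub_apply, LinearMap.add_apply,
      LinearMap.smul_apply, smul_eq_mul] at this
    exact sub_eq_zero.1 this
  have hfin : ∀ x y, wedgeForm hm.le b h x y = φ x * ψ y - φ y * ψ x := by
    intro x y
    rw [hdec x y, neg_of_self_eq_zero hB y x₀, neg_of_self_eq_zero hB y y₀, hdec y x₀, hdec y y₀,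
      hB, hB, h1, neg_of_self_eq_zero hB x₀ y₀, h1]
    ring
  refine ⟨h, ⟨fun h0 => ?_, _, hsm.symm⟩, le_antisymm (fun x hx => ?_) hWann, hfin⟩
  · rw [h0, wedgeForm_apply, map_zero, map_zero] at h1
    exact zero_ne_one h1
  · have e1 := hfin x y₀
    have e2 := hfin x x₀
    rw [wedgeForm_eq_zero_of_mem_annihilator hm.le b hx] at e1 e2
    simp only [hφx, hφy, hψx, hψy] at e1 e2
    exact ⟨by simpa using e1.symm, by simpa using e2.symm⟩

end Decomposable

/-- The arithmetic of the weight formula: the weight is at least `q^(a+n-3)`, and equality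
singles out two possibilities for the dimensions of the radicals. -/
theorem weight_bound {q w : ℤ} (hq : 2 ≤ q) {a n k t : ℕ} (hk : k < a) (han : a < n)
    (hta : k + 1 = a → t = a) (hkt : k ≤ t) (htk : n = a + 1 → t ≤ k + 1)
    (hw : q ^ 2 * (q ^ 2 - 1) * w =
      (q + 1) * q ^ n * (q ^ a - q ^ k) - q ^ (a + 1) * (q ^ a - q ^ t)) :
    q ^ (a + n - 3) ≤ w ∧
      (w = q ^ (a + n - 3) ↔ k + 1 = a ∨ n = a + 1 ∧ k + 2 = a ∧ t = k) := by
  have hq0 : (0 : ℤ) < q := by linarith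
  have hfac : (0 : ℤ) < q ^ 2 * (q ^ 2 - 1) := by
    have : (0 : ℤ) < q ^ 2 - 1 := by nlinarith
    positivity
  obtain ⟨e, rfl⟩ : ∃ e, a = k + 1 + e := ⟨a - (k + 1), by omega⟩
  obtain ⟨d, rfl⟩ : ∃ d, n = k + 1 + e + 1 + d := ⟨n - (k + 1 + e + 1), by omega⟩
  obtain ⟨u, rfl⟩ : ∃ u, t = k + u := ⟨t - k, by omega⟩
  have hexp : k + 1 + e + (k + 1 + e + 1 + d) - 3 = 2 * k + 2 * e + d := by omega
  rw [hexp]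
  -- With e = a-k-1, d = n-a-1 and u = t-k, the sign of the excess over the bound is that of the
  -- bracket on the right.
  have hdiff : q ^ 2 * (q ^ 2 - 1) * (w - q ^ (2 * k + 2 * e + d)) =
      q ^ (2 * k) * q ^ (e + 2) *
        ((q + 1) * q ^ d * (q ^ e - 1) - q ^ (e + 1) + q ^ u) := by
    rw [mul_sub, hw]; ring
  have hQ : (0 : ℤ) < q ^ (2 * k) * q ^ (e + 2) := by positivity
  have fin_pos : 0 < (q + 1) * q ^ d * (q ^ e - 1) - q ^ (e + 1) + q ^ u →
      ¬ (k + 1 = k + 1 + e ∨ k + 1 + e + 1 + d = k + 1 + e + 1 ∧ k + 2 = k + 1 + e ∧ k + u = k) →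
      q ^ (2 * k + 2 * e + d) ≤ w ∧
      (w = q ^ (2 * k + 2 * e + d) ↔ k + 1 = k + 1 + e ∨
        k + 1 + e + 1 + d = k + 1 + e + 1 ∧ k + 2 = k + 1 + e ∧ k + u = k) := by
    intro hp hn
    have : 0 < w - q ^ (2 * k + 2 * e + d) :=
      pos_of_mul_pos_right (hdiff ▸ mul_pos hQ hp) hfac.le
    exact ⟨by linarith, fun h => absurd h (by linarith), fun h => absurd h hn⟩
  have fin_zero : (q + 1) * q ^ d * (q ^ e - 1) - q ^ (e + 1) + q ^ u = 0 →
      (k + 1 = k + 1 + e ∨ k + 1 + e + 1 + d = k + 1 + e + 1 ∧ k + 2 = k + 1 + e ∧ k + u = k) →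
      q ^ (2 * k + 2 * e + d) ≤ w ∧
      (w = q ^ (2 * k + 2 * e + d) ↔ k + 1 = k + 1 + e ∨
        k + 1 + e + 1 + d = k + 1 + e + 1 ∧ k + 2 = k + 1 + e ∧ k + u = k) := by
    intro hp hn
    have : w - q ^ (2 * k + 2 * e + d) = 0 := by
      rw [hp, mul_zero] at hdiff
      exact (mul_eq_zero.1 hdiff).resolve_left hfac.ne'
    exact ⟨by linarith, fun _ => hn, fun _ => by linarith⟩
  have hpu : (0 : ℤ) < q ^ u := by positivity
  -- For e = 0 the radical has codimension one, `hta` forces u = 1, and the bracket is -q + q = 0.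
  rcases Nat.eq_zero_or_pos e with rfl | he
  · obtain rfl : u = 1 := by have := hta (by omega); omega
    exact fin_zero (by ring) (Or.inl rfl)
  obtain ⟨e, rfl⟩ : ∃ e', e = e' + 1 := ⟨e - 1, by omega⟩
  have hpe : (1 : ℤ) ≤ q ^ e := one_le_pow₀ (by linarith)
  -- From here e stands for a-k-2. For d = 0 the bracket is q(q^e - 1) when u = 0, vanishing only at
  -- e = 0, and q^(e+1) - 1 > 0 when u = 1. For d > 0 it is positive, by comparison with d = 1.
  rcases Nat.eq_zero_or_pos d with rfl | hd
  · have hu : u ≤ 1 := by have := htk (by omega); omega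
    interval_cases u
    · rcases Nat.eq_zero_or_pos e with rfl | he'
      · exact fin_zero (by ring) (Or.inr ⟨rfl, rfl, rfl⟩)
      · refine fin_pos ?_ (by omega)
        have hqe : q ≤ q ^ e := by
          simpa using pow_le_pow_right₀ (by linarith : (1 : ℤ) ≤ q) he'
        have : (q + 1) * q ^ 0 * (q ^ (e + 1) - 1) - q ^ (e + 1 + 1) + q ^ 0 =
          q * (q ^ e - 1) := by ring
        rw [this]
        exact mul_pos hq0 (by linarith)
    · refine fin_pos ?_ (by omega)
      have : (q + 1) * q ^ 0 * (q ^ (e + 1) - 1) - q ^ (e + 1 + 1) + q ^ 1 =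
          q * q ^ e - 1 := by ring
      rw [this]
      nlinarith
  · refine fin_pos ?_ (by omega)
    have hqd : q ≤ q ^ d := by
      simpa using pow_le_pow_right₀ (by linarith : (1 : ℤ) ≤ q) hd
    have h0 : 0 ≤ q ^ (e + 1) - 1 := by
      have : (1 : ℤ) ≤ q ^ (e + 1) := one_le_pow₀ (by linarith)
      linarith
    have h1 : (q + 1) * q * (q ^ (e + 1) - 1) ≤ (q + 1) * q ^ d * (q ^ (e + 1) - 1) := by
      gcongr
    have h2 : (q + 1) * q * (q ^ (e + 1) - 1) - q ^ (e + 1 + 1) =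
        q * ((q * q) * (q ^ e - 1) + (q * q - q - 1)) := by ring
    have h3 : 0 < q * q - q - 1 := by nlinarith
    have h4 : 0 ≤ (q * q) * (q ^ e - 1) := mul_nonneg (by positivity) (by linarith)
    have h5 : 0 < q * ((q * q) * (q ^ e - 1) + (q * q - q - 1)) := mul_pos hq0 (by linarith)
    linarith

/-! ### Counting non-orthogonal pairs and the weight formula -/

section Counting

variable {K : Type*} [Field K] {V : Type*} [AddCommGroup V] [Module K V]

theorem finrank_inf_ker_add_one [FiniteDimensional K V] (S : Submodule K V) (g : V →ₗ[K] K) {y : V}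
    (hy : y ∈ S) (hgy : g y ≠ 0) : finrank K ↥(S ⊓ LinearMap.ker g) + 1 = finrank K S := by
  have h := LinearMap.finrank_range_add_finrank_ker (g.domRestrict S)
  have hr : LinearMap.range (g.domRestrict S) = ⊤ :=
    LinearMap.range_eq_top.2 (LinearMap.surjective (fun h0 => hgy (by
      simpa using LinearMap.congr_fun h0 ⟨y, hy⟩)))
  have hk : finrank K (LinearMap.ker (g.domRestrict S)) = finrank K ↥(S ⊓ LinearMap.ker g) := by
    rw [← Submodule.map_comap_subtype, Submodule.finrank_map_subtype_eq]
    rfl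
  rw [hr, finrank_top, finrank_self, hk] at h
  omega

theorem finrank_le_finrank_inf_ker_add_one [FiniteDimensional K V] (S : Submodule K V)
    (g : V →ₗ[K] K) : finrank K S ≤ finrank K ↥(S ⊓ LinearMap.ker g) + 1 := by
  by_cases h : ∃ y ∈ S, g y ≠ 0
  · obtain ⟨y, hy, hgy⟩ := h
    exact (finrank_inf_ker_add_one S g hy hgy).ge
  · push Not at h
    rw [inf_eq_left.2 fun w hw => h w hw]
    exact Nat.le_succ _

/-- The vectors of `S` that are orthogonal to `T`. -/
def leftRadical (B : V →ₗ[K] V →ₗ[K] K) (S T : Submodule K V) : Submodule K V where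
  carrier := {x | x ∈ S ∧ ∀ y ∈ T, B x y = 0}
  add_mem' := fun ⟨hx, hx'⟩ ⟨hy, hy'⟩ =>
    ⟨S.add_mem hx hy, fun z hz => by simp [hx' z hz, hy' z hz]⟩
  zero_mem' := ⟨S.zero_mem, fun z _ => by simp⟩
  smul_mem' := fun c _ ⟨hx, hx'⟩ => ⟨S.smul_mem c hx, fun z hz => by simp [hx' z hz]⟩

theorem mem_leftRadical {B : V →ₗ[K] V →ₗ[K] K} {S T : Submodule K V} {x : V} :
    x ∈ leftRadical B S T ↔ x ∈ S ∧ ∀ y ∈ T, B x y = 0 := Iff.rfl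

open Classical in
/-- The number of pairs in `S × T` that are not orthogonal. -/
noncomputable def pairCount [Fintype V] (B : V →ₗ[K] V →ₗ[K] K) (S T : Submodule K V) : ℕ :=
  (Finset.univ.filter fun p : V × V => p.1 ∈ S ∧ p.2 ∈ T ∧ B p.1 p.2 ≠ 0).card

open Classical in
theorem card_filter_mem [Fintype K] [Fintype V] (S : Submodule K V) :
    (Finset.univ.filter fun x : V => x ∈ S).card = Fintype.card K ^ finrank K S := by
  rw [← Module.card_eq_pow_finrank (K := K) (V := S), Fintype.card_subtype]

open Classical in
theorem card_filter_ne_zero [Fintype K] [Fintype V] (T : Submodule K V) (g : V →ₗ[K] K)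
    (hg : ∃ y ∈ T, g y ≠ 0) :
    (Fintype.card K : ℤ) * (Finset.univ.filter fun y : V => y ∈ T ∧ g y ≠ 0).card =
      (Fintype.card K - 1) * (Fintype.card K : ℤ) ^ finrank K T := by
  obtain ⟨y, hy, hgy⟩ := hg
  have h1 := finrank_inf_ker_add_one T g hy hgy
  have h2 := Finset.card_filter_add_card_filter_not (s := Finset.univ.filter fun y : V => y ∈ T)
    (fun y => g y ≠ 0)
  rw [Finset.filter_filter, Finset.filter_filter, card_filter_mem] at h2
  have h3 : (Finset.univ.filter fun y : V => y ∈ T ∧ ¬ g y ≠ 0).card =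
      Fintype.card K ^ finrank K ↥(T ⊓ LinearMap.ker g) := by
    rw [← card_filter_mem]; congr 1; ext z; simp
  rw [h3, ← h1] at h2
  have h4 : ((Finset.univ.filter fun y : V => y ∈ T ∧ g y ≠ 0).card : ℤ) +
      (Fintype.card K : ℤ) ^ finrank K ↥(T ⊓ LinearMap.ker g) =
      (Fintype.card K : ℤ) ^ (finrank K ↥(T ⊓ LinearMap.ker g) + 1) := by exact_mod_cast h2
  rw [← h1, eq_sub_of_add_eq h4]
  ring

/-- A vector of S outside the radical is a nonzero functional on T, hence nonzero off a hyperplane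
of T; a vector of the radical contributes nothing. The factor q on the left avoids the exponent dim
T - 1. -/
theorem card_mul_pairCount [Fintype K] [Fintype V] (B : V →ₗ[K] V →ₗ[K] K) (S T : Submodule K V) :
    (Fintype.card K : ℤ) * pairCount B S T =
      (Fintype.card K - 1) * (Fintype.card K : ℤ) ^ finrank K T *
        ((Fintype.card K : ℤ) ^ finrank K S -
          (Fintype.card K : ℤ) ^ finrank K (leftRadical B S T)) := by
  classical
  have h1 : (pairCount B S T : ℤ) = ∑ x : V, if x ∈ S then
      ((Finset.univ.filter fun y : V => y ∈ T ∧ B x y ≠ 0).card : ℤ) else 0 := by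
    rw [pairCount, Finset.card_filter, Fintype.sum_prod_type]
    push_cast
    refine Finset.sum_congr rfl fun x _ => ?_
    by_cases hx : x ∈ S <;> simp [hx]
  have h2 : ∀ x : V, (Fintype.card K : ℤ) * (if x ∈ S then
      ((Finset.univ.filter fun y : V => y ∈ T ∧ B x y ≠ 0).card : ℤ) else 0) =
      (Fintype.card K - 1) * (Fintype.card K : ℤ) ^ finrank K T *
        ((if x ∈ S then 1 else 0) - (if x ∈ leftRadical B S T then 1 else 0)) := by
    intro x
    by_cases hx : x ∈ S
    · by_cases hr : x ∈ leftRadical B S T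
      · have : (Finset.univ.filter fun y : V => y ∈ T ∧ B x y ≠ 0) = ∅ :=
          Finset.filter_eq_empty_iff.2 fun y _ h => h.2 (hr.2 y h.1)
        simp [hx, hr, this]
      · have : ∃ y ∈ T, B x y ≠ 0 := by
          by_contra! h
          exact hr ⟨hx, h⟩
        rw [if_pos hx, if_pos hx, if_neg hr, card_filter_ne_zero T (B x) this]
        ring
    · have hr : x ∉ leftRadical B S T := fun h => hx h.1
      simp [hx, hr]
  rw [h1, Finset.mul_sum, Finset.sum_congr rfl fun x _ => h2 x, ← Finset.mul_sum,
    Finset.sum_sub_distrib, ← Finset.natCast_card_filter, ← Finset.natCast_card_filter,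
    card_filter_mem, card_filter_mem]
  push_cast
  rfl

variable {B : V →ₗ[K] V →ₗ[K] K}

theorem pairCount_eq_zero [Fintype V] {S T : Submodule K V} (h : ∀ x ∈ S, ∀ y ∈ T, B x y = 0) :
    pairCount B S T = 0 := by
  classical
  rw [pairCount, Finset.card_eq_zero, Finset.filter_eq_empty_iff]
  rintro p - ⟨h1, h2, h3⟩
  exact h3 (h _ h1 _ h2)

variable (hB : ∀ x, B x x = 0)
include hB

theorem linearIndependent_pair {x y : V} (h : B x y ≠ 0) : LinearIndependent K ![x, y] := by
  rw [LinearIndependent.pair_iff]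
  intro s t hst
  have e1 : B (s • x + t • y) y = 0 := by rw [hst]; simp
  have e2 : B x (s • x + t • y) = 0 := by rw [hst]; simp
  simp only [map_add, map_smul, LinearMap.add_apply, LinearMap.smul_apply, hB, smul_eq_mul,
    mul_zero, add_zero, zero_add, mul_eq_zero, h, or_false] at e1 e2
  exact ⟨e1, e2⟩

theorem finrank_span_pair_eq_two {x y : V} (h : B x y ≠ 0) :
    finrank K (Submodule.span K {x, y}) = 2 := by
  have := finrank_span_eq_card (linearIndependent_pair hB h)
  rwa [Matrix.range_cons_cons_empty, Fintype.card_fin] at this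

theorem leftRadical_span_pair {x y : V} (h : B x y ≠ 0) {S : Submodule K V}
    (hS : S ≤ Submodule.span K {x, y}) : leftRadical B S (Submodule.span K {x, y}) = ⊥ := by
  rw [eq_bot_iff]
  rintro z ⟨hz, hz'⟩
  obtain ⟨r, s, rfl⟩ := Submodule.mem_span_pair.1 (hS hz)
  have e1 := hz' x (Submodule.subset_span (by simp))
  have e2 := hz' y (Submodule.subset_span (by simp))
  have h' : B y x ≠ 0 := by rw [neg_of_self_eq_zero hB x y]; exact neg_ne_zero.2 h
  simp only [map_add, map_smul, LinearMap.add_apply, LinearMap.smul_apply, hB, smul_eq_mul,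
    mul_zero, add_zero, zero_add, mul_eq_zero, h, h', or_false] at e1 e2
  simp [e1, e2]

variable [FiniteDimensional K V]

theorem two_le_finrank_of_apply_ne_zero {S : Submodule K V} {x y : V} (hx : x ∈ S) (hy : y ∈ S)
    (h : B x y ≠ 0) : 2 ≤ finrank K S := by
  rw [← finrank_span_pair_eq_two hB h]
  refine Submodule.finrank_mono (Submodule.span_le.2 ?_)
  rintro z (rfl | rfl) <;> assumption

theorem span_pair_eq {L : Submodule K V} (hL : finrank K L = 2) {x y : V} (hx : x ∈ L)
    (hy : y ∈ L) (h : B x y ≠ 0) : Submodule.span K {x, y} = L := by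
  refine Submodule.eq_of_le_of_finrank_eq (Submodule.span_le.2 ?_)
    (by rw [finrank_span_pair_eq_two hB h, hL])
  rintro z (rfl | rfl) <;> assumption

theorem pairCount_eq_zero_of_finrank_le_one [Fintype V] {S : Submodule K V}
    (hS : finrank K S ≤ 1) : pairCount B S S = 0 := by
  refine pairCount_eq_zero fun x h1 y h2 => ?_
  by_contra h3
  have := two_le_finrank_of_apply_ne_zero hB h1 h2 h3
  omega

/-- The coefficients q+1 and -q are chosen so that L contributes the same whether it meets S in a
line (the second count is then 0) or lies in S (the two counts then agree). -/
theorem pairCount_line [Fintype K] [Fintype V] {L S T : Submodule K V} (hL : finrank K L = 2)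
    (hS : 1 ≤ finrank K ↥(L ⊓ S)) (hT : L ≤ T) {u v : V} (huv : Submodule.span K {u, v} = L)
    (h : B u v ≠ 0) :
    ((Fintype.card K : ℤ) + 1) * pairCount B (L ⊓ S) (L ⊓ T) -
      Fintype.card K * pairCount B (L ⊓ S) (L ⊓ S) =
      ((Fintype.card K : ℤ) ^ 2 - 1) * ((Fintype.card K : ℤ) ^ 2 - Fintype.card K) := by
  have hq : (Fintype.card K : ℤ) ≠ 0 := by exact_mod_cast Fintype.card_ne_zero
  have h1 := card_mul_pairCount B (L ⊓ S) L
  have hr : leftRadical B (L ⊓ S) L = ⊥ := by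
    rw [← huv]; exact leftRadical_span_pair hB h inf_le_left
  rw [hr, finrank_bot, hL, pow_zero] at h1
  rw [inf_eq_left.2 hT]
  have hle : finrank K ↥(L ⊓ S) ≤ 2 := hL ▸ Submodule.finrank_mono inf_le_left
  apply mul_left_cancel₀ hq
  rcases (by omega : finrank K ↥(L ⊓ S) = 1 ∨ finrank K ↥(L ⊓ S) = 2) with h2 | h2
  · rw [pairCount_eq_zero_of_finrank_le_one hB h2.le]
    rw [h2] at h1
    push_cast
    linear_combination ((Fintype.card K : ℤ) + 1) * h1
  · have hLS : L ⊓ S = L := Submodule.eq_of_le_of_finrank_eq inf_le_left (by rw [h2, hL])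
    rw [h2] at h1
    rw [hLS] at h1 ⊢
    linear_combination h1

/-- A non-orthogonal pair is independent, so the plane it spans is the only L that contains it. That
plane is in the Schubert variety because its first vector is a nonzero element of `A 0`. -/
theorem pairCount_eq_sum [Fintype V] {A : Fin 2 → Submodule K V} (hA : Monotone A) {n : ℕ}
    (L : Fin n ≃ ↥(schubertVariety A)) {S T : Submodule K V} (hS : S ≤ A 0) (hT : T ≤ A 1) :
    pairCount B S T =
      ∑ j, pairCount B ((L j : Submodule K V) ⊓ S) ((L j : Submodule K V) ⊓ T) := by
  classical
  have hinj : Function.Injective fun j => (L j : Submodule K V) :=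
    Subtype.val_injective.comp L.injective
  rw [pairCount, Finset.card_eq_sum_card_fiberwise
    (f := fun p : V × V => Submodule.span K {p.1, p.2})
    (t := Finset.univ.map ⟨fun j => (L j : Submodule K V), hinj⟩), Finset.sum_map]
  · refine Finset.sum_congr rfl fun j _ => ?_
    rw [pairCount]
    congr 1
    ext p
    simp only [Finset.mem_filter, Finset.mem_univ, true_and, Function.Embedding.coeFn_mk,
      Submodule.mem_inf]
    constructor
    · rintro ⟨⟨h1, h2, h3⟩, h4⟩
      rw [← h4]
      exact ⟨⟨Submodule.subset_span (by simp), h1⟩, ⟨Submodule.subset_span (by simp), h2⟩, h3⟩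
    · rintro ⟨⟨h1, h1'⟩, ⟨h2, h2'⟩, h3⟩
      exact ⟨⟨h1', h2', h3⟩, span_pair_eq hB (L j).2.1 h1 h2 h3⟩
  · intro p hp
    obtain ⟨h1, h2, h3⟩ := (Finset.mem_filter.1 hp).2
    have hx : p.1 ∈ Submodule.span K {p.1, p.2} := Submodule.subset_span (by simp)
    have hmem : Submodule.span K {p.1, p.2} ∈ schubertVariety A := by
      refine ⟨finrank_span_pair_eq_two hB h3, fun i => ?_⟩
      fin_cases i
      · change 0 + 1 ≤ _
        rw [zero_add, Nat.one_le_iff_ne_zero, Ne, Submodule.finrank_eq_zero]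
        intro (h0 : Submodule.span K {p.1, p.2} ⊓ A 0 = ⊥)
        have : p.1 ∈ Submodule.span K {p.1, p.2} ⊓ A 0 := ⟨hx, hS h1⟩
        rw [h0, Submodule.mem_bot] at this
        rw [this] at h3
        simp at h3
      · change 1 + 1 ≤ _
        refine two_le_finrank_of_apply_ne_zero hB (x := p.1) (y := p.2)
          ⟨hx, hA (Fin.zero_le _) (hS h1)⟩ ⟨Submodule.subset_span (by simp), hT h2⟩ h3
    refine Finset.mem_coe.2 (Finset.mem_map.2 ⟨L.symm ⟨_, hmem⟩, Finset.mem_univ _, ?_⟩)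
    simp

/-- The weight of the codeword of an alternating form, in terms of numbers of pairs. -/
theorem hammingNorm_eq_pairCount [Fintype K] [DecidableEq K] [Fintype V]
    {A : Fin 2 → Submodule K V} (hA : Monotone A) {n : ℕ} (L : Fin n ≃ ↥(schubertVariety A))
    {c : Fin n → K}
    (hc : ∀ j, ∃ u v, Submodule.span K {u, v} = (L j : Submodule K V) ∧ c j = B u v) :
    ((Fintype.card K : ℤ) ^ 2 - 1) * ((Fintype.card K : ℤ) ^ 2 - Fintype.card K) * hammingNorm c =
      ((Fintype.card K : ℤ) + 1) * pairCount B (A 0) (A 1) -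
        Fintype.card K * pairCount B (A 0) (A 0) := by
  rw [pairCount_eq_sum hB hA L le_rfl le_rfl,
    pairCount_eq_sum hB hA L le_rfl (hA (Fin.zero_le 1)), hammingNorm, Finset.card_filter]
  push_cast
  rw [Finset.mul_sum, Finset.mul_sum, Finset.mul_sum, ← Finset.sum_sub_distrib]
  refine Finset.sum_congr rfl fun j _ => ?_
  obtain ⟨u, v, huv, hcj⟩ := hc j
  obtain ⟨hL, hLA⟩ := (L j).2
  by_cases h : B u v = 0
  · have hzero : ∀ S T : Submodule K V,
        pairCount B ((L j : Submodule K V) ⊓ S) ((L j : Submodule K V) ⊓ T) = 0 := by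
      intro S T
      refine pairCount_eq_zero ?_
      rintro x ⟨h1, -⟩ y ⟨h2, -⟩
      rw [← huv] at h1 h2
      obtain ⟨r, s, h1⟩ := Submodule.mem_span_pair.1 h1
      obtain ⟨r', s', h2⟩ := Submodule.mem_span_pair.1 h2
      rw [← h1, ← h2]
      simp [hB, h, neg_of_self_eq_zero hB u v]
    simp [hcj, h, hzero]
  · have hT : (L j : Submodule K V) ≤ A 1 := by
      have h2 := hLA 1
      have : (L j : Submodule K V) ⊓ A 1 = L j :=
        Submodule.eq_of_le_of_finrank_le inf_le_left (by rw [hL]; exact h2)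
      exact inf_eq_left.1 this
    rw [if_pos (by rwa [hcj]), mul_one, pairCount_line hB hL (hLA 0) hT huv h]

/-- The radical of an alternating form on `S` cannot have codimension one. -/
theorem apply_eq_zero_of_finrank_leftRadical {S T : Submodule K V} (hST : S ≤ T)
    (h : finrank K (leftRadical B S T) + 1 = finrank K S) {u v : V} (hu : u ∈ S) (hv : v ∈ S) :
    B u v = 0 := by
  by_contra huv
  -- If B(u, v) ≠ 0, then B(v, ·) and B(u, ·) are independent on S, and the radical lies in their
  -- common kernel, of codimension two.
  have hle : leftRadical B S T ≤ (S ⊓ LinearMap.ker (B v)) ⊓ LinearMap.ker (B u) := by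
    intro z hz
    refine ⟨⟨hz.1, ?_⟩, ?_⟩
    · change B v z = 0
      rw [neg_of_self_eq_zero hB z v, hz.2 v (hST hv), neg_zero]
    · change B u z = 0
      rw [neg_of_self_eq_zero hB z u, hz.2 u (hST hu), neg_zero]
  have hvu : B v u ≠ 0 := by rw [neg_of_self_eq_zero hB u v]; exact neg_ne_zero.2 huv
  have e1 := finrank_inf_ker_add_one S (B v) hu hvu
  have e2 := finrank_inf_ker_add_one (S ⊓ LinearMap.ker (B v)) (B u) (y := v) ⟨hv, hB v⟩ huv
  have e3 := Submodule.finrank_mono hle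
  omega

/-- The radicals of an alternating form on a partial flag determine the weight of its codeword. -/
theorem pow_le_hammingNorm [Fintype K] [DecidableEq K]
    {A : Fin 2 → Submodule K V} (hA : StrictMono A) {n : ℕ} (L : Fin n ≃ ↥(schubertVariety A))
    {c : Fin n → K}
    (hc : ∀ j, ∃ u v, Submodule.span K {u, v} = (L j : Submodule K V) ∧ c j = B u v)
    (hne : ∃ x ∈ A 0, ∃ y ∈ A 1, B x y ≠ 0) :
    Fintype.card K ^ (finrank K (A 0) + finrank K (A 1) - 3) ≤ hammingNorm c ∧
      (hammingNorm c = Fintype.card K ^ (finrank K (A 0) + finrank K (A 1) - 3) ↔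
        finrank K (leftRadical B (A 0) (A 1)) + 1 = finrank K (A 0) ∨
        finrank K (A 1) = finrank K (A 0) + 1 ∧
          finrank K (leftRadical B (A 0) (A 1)) + 2 = finrank K (A 0) ∧
          finrank K (leftRadical B (A 0) (A 0)) = finrank K (leftRadical B (A 0) (A 1))) := by
  have := Module.finite_of_finite K (M := V)
  have := Fintype.ofFinite V
  obtain ⟨x, hx, y, hy, hxy⟩ := hne
  have h01 : A 0 < A 1 := hA Fin.zero_lt_one
  have hlt : finrank K (A 0) < finrank K (A 1) := Submodule.finrank_lt_finrank_of_lt h01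
  have hK : leftRadical B (A 0) (A 1) < A 0 := by
    refine lt_of_le_of_ne (fun z hz => hz.1) fun h => ?_
    rw [← h] at hx
    exact hxy (hx.2 y hy)
  have hKlt := Submodule.finrank_lt_finrank_of_lt hK
  have hKR : leftRadical B (A 0) (A 1) ≤ leftRadical B (A 0) (A 0) :=
    fun z hz => ⟨hz.1, fun y hy => hz.2 y (h01.le hy)⟩
  have hRle : finrank K (leftRadical B (A 0) (A 0)) ≤ finrank K (A 0) :=
    Submodule.finrank_mono fun z hz => hz.1
  have hta : finrank K (leftRadical B (A 0) (A 1)) + 1 = finrank K (A 0) →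
      finrank K (leftRadical B (A 0) (A 0)) = finrank K (A 0) := by
    intro h
    exact le_antisymm hRle (Submodule.finrank_mono fun u hu =>
      ⟨hu, fun v hv => apply_eq_zero_of_finrank_leftRadical hB h01.le h hu hv⟩)
  have htk : finrank K (A 1) = finrank K (A 0) + 1 →
      finrank K (leftRadical B (A 0) (A 0)) ≤ finrank K (leftRadical B (A 0) (A 1)) + 1 := by
    intro h
    -- Here A₂ = A₁ + ⟨z⟩, so orthogonality to A₂ is one linear condition more than orthogonality to
    -- A₁.
    obtain ⟨z, hz, hz'⟩ := SetLike.exists_of_lt h01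
    have hsup : A 0 ⊔ Submodule.span K {z} = A 1 := by
      have hle : A 0 ⊔ Submodule.span K {z} ≤ A 1 :=
        sup_le h01.le ((Submodule.span_singleton_le_iff_mem _ _).2 hz)
      refine Submodule.eq_of_le_of_finrank_le hle ?_
      have : A 0 < A 0 ⊔ Submodule.span K {z} := by
        refine lt_of_le_of_ne le_sup_left fun h => hz' ?_
        rw [h]
        exact Submodule.mem_sup_right (Submodule.mem_span_singleton_self z)
      have := Submodule.finrank_lt_finrank_of_lt this
      omega
    have hle : leftRadical B (A 0) (A 0) ⊓ LinearMap.ker (B z) ≤ leftRadical B (A 0) (A 1) := by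
      rintro w ⟨hw, hw'⟩
      refine ⟨hw.1, fun y hy => ?_⟩
      rw [← hsup] at hy
      obtain ⟨a, ha, s, hs, rfl⟩ := Submodule.mem_sup.1 hy
      obtain ⟨r, rfl⟩ := Submodule.mem_span_singleton.1 hs
      have hw'' : B w z = 0 := by
        rw [neg_of_self_eq_zero hB z w, LinearMap.mem_ker.1 hw', neg_zero]
      simp [hw.2 a ha, hw'']
    have hle' := Submodule.finrank_mono hle
    have := finrank_le_finrank_inf_ker_add_one (leftRadical B (A 0) (A 0)) (B z)
    omega
  have hq : (2 : ℤ) ≤ Fintype.card K := by exact_mod_cast Fintype.one_lt_card (α := K)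
  have hw : (Fintype.card K : ℤ) ^ 2 * ((Fintype.card K : ℤ) ^ 2 - 1) * hammingNorm c =
      ((Fintype.card K : ℤ) + 1) * (Fintype.card K : ℤ) ^ finrank K (A 1) *
        ((Fintype.card K : ℤ) ^ finrank K (A 0) -
          (Fintype.card K : ℤ) ^ finrank K (leftRadical B (A 0) (A 1))) -
      (Fintype.card K : ℤ) ^ (finrank K (A 0) + 1) *
        ((Fintype.card K : ℤ) ^ finrank K (A 0) -
          (Fintype.card K : ℤ) ^ finrank K (leftRadical B (A 0) (A 0))) := by
    have e0 := hammingNorm_eq_pairCount hB hA.monotone L hc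
    have e1 := card_mul_pairCount B (A 0) (A 1)
    have e2 := card_mul_pairCount B (A 0) (A 0)
    have hq1 : (Fintype.card K : ℤ) - 1 ≠ 0 := by linarith
    apply mul_left_cancel₀ hq1
    linear_combination (Fintype.card K : ℤ) * e0 + ((Fintype.card K : ℤ) + 1) * e1 -
      (Fintype.card K : ℤ) * e2
  obtain ⟨h1, h2⟩ := weight_bound hq hKlt hlt hta (Submodule.finrank_mono hKR) htk hw
  exact ⟨by exact_mod_cast h1, by rw [← h2]; norm_cast⟩

end Counting

/-! ### Extremal radicals and Schubert decomposable elements -/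

section MinimumWeight

variable {K : Type*} [Field K] {V : Type*} [AddCommGroup V] [Module K V]

/-- The codimension hypothesis says that B(·, y₀) and B(x₀, ·) are independent on T. A combination
of them vanishing on T, such as B(x, ·), therefore has both coefficients zero. -/
theorem leftRadical_eq_inf [FiniteDimensional K V] {B : V →ₗ[K] V →ₗ[K] K} {x₀ y₀ : V}
    {W S T : Submodule K V} (hW : ∀ x, x ∈ W ↔ B x y₀ = 0 ∧ B x₀ x = 0)
    (hform : ∀ x y, B x y = B x y₀ * B x₀ y - B y y₀ * B x₀ x)
    (hT : finrank K ↥(W ⊓ T) + 2 = finrank K T) : leftRadical B S T = W ⊓ S := by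
  ext x
  rw [mem_leftRadical, Submodule.mem_inf, and_comm]
  refine and_congr_left fun _ => ⟨fun hx => (hW x).2 ?_, fun hx y _ => ?_⟩
  · constructor
    · by_contra h0
      have hle : T ⊓ LinearMap.ker (B.flip y₀) ≤ W ⊓ T := by
        rintro z ⟨hz, hz'⟩
        have hz' : B z y₀ = 0 := hz'
        have := hx z hz
        rw [hform, hz', zero_mul, sub_zero] at this
        exact ⟨(hW z).2 ⟨hz', (mul_eq_zero.1 this).resolve_left h0⟩, hz⟩
      have := Submodule.finrank_mono hle
      have := finrank_le_finrank_inf_ker_add_one T (B.flip y₀)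
      omega
    · by_contra h0
      have hle : T ⊓ LinearMap.ker (B x₀) ≤ W ⊓ T := by
        rintro z ⟨hz, hz'⟩
        have hz' : B x₀ z = 0 := hz'
        have := hx z hz
        rw [hform, hz', mul_zero, zero_sub, neg_eq_zero] at this
        exact ⟨(hW z).2 ⟨(mul_eq_zero.1 this).resolve_right h0, hz'⟩, hz⟩
      have := Submodule.finrank_mono hle
      have := finrank_le_finrank_inf_ker_add_one T (B x₀)
      omega
  · obtain ⟨h1, h2⟩ := (hW x).1 hx
    rw [hform, h1, h2]
    ring

variable {m : ℕ} (b : Basis (Fin m) K V) {A : Fin 2 → Submodule K V}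

/-- The radicals of the form attached to a Schubert decomposable element. -/
theorem IsSchubertDecomposable.finrank_leftRadical (hm : 2 ≤ m) (hA : StrictMono A)
    {h : ⋀[K]^(m - 2) V} (hh : IsSchubertDecomposable A h) :
    (∃ x ∈ A 0, ∃ y ∈ A 1, wedgeForm hm b h x y ≠ 0) ∧
    (finrank K (leftRadical (wedgeForm hm b h) (A 0) (A 1)) + 1 = finrank K (A 0) ∨
        finrank K (A 1) = finrank K (A 0) + 1 ∧
          finrank K (leftRadical (wedgeForm hm b h) (A 0) (A 1)) + 2 = finrank K (A 0) ∧
          finrank K (leftRadical (wedgeForm hm b h) (A 0) (A 0)) =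
            finrank K (leftRadical (wedgeForm hm b h) (A 0) (A 1))) := by
  have := Module.Finite.of_basis b
  obtain ⟨hdec, hdim⟩ := hh
  obtain ⟨x₀, y₀, -, hW, hform⟩ := hdec.exists_wedgeForm_eq hm b
  set B := wedgeForm hm b h
  have h01 : A 0 < A 1 := hA Fin.zero_lt_one
  have hlt : finrank K (A 0) < finrank K (A 1) := Submodule.finrank_lt_finrank_of_lt h01
  have h1 : finrank K ↥(annihilator h ⊓ A 1) + 2 = finrank K (A 1) := hdim 1 (Or.inl rfl)
  have h0 : finrank K (A 0) + 2 ≤ finrank K (A 1) →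
      finrank K ↥(annihilator h ⊓ A 0) + 1 = finrank K (A 0) := fun hle =>
    hdim 0 (Or.inr ⟨Nat.one_lt_two, hle⟩)
  have hk : leftRadical B (A 0) (A 1) = annihilator h ⊓ A 0 := leftRadical_eq_inf hW hform h1
  have hmono : finrank K ↥(annihilator h ⊓ A 0) ≤ finrank K ↥(annihilator h ⊓ A 1) :=
    Submodule.finrank_mono (inf_le_inf_left _ h01.le)
  have hcodim : finrank K (A 0) ≤ finrank K ↥(annihilator h ⊓ A 0) + 2 := by
    have e1 := finrank_le_finrank_inf_ker_add_one (A 0) (B.flip y₀)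
    have e2 := finrank_le_finrank_inf_ker_add_one (A 0 ⊓ LinearMap.ker (B.flip y₀)) (B x₀)
    have : A 0 ⊓ LinearMap.ker (B.flip y₀) ⊓ LinearMap.ker (B x₀) ≤ annihilator h ⊓ A 0 := by
      rintro z ⟨⟨hz1, hz2⟩, hz3⟩
      exact ⟨(hW z).2 ⟨hz2, hz3⟩, hz1⟩
    have := Submodule.finrank_mono this
    omega
  have hklt : finrank K ↥(annihilator h ⊓ A 0) < finrank K (A 0) := by
    by_cases hle : finrank K (A 0) + 2 ≤ finrank K (A 1)
    · have := h0 hle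
      omega
    · omega
  constructor
  · by_contra! hcon
    have : leftRadical B (A 0) (A 1) = A 0 :=
      le_antisymm (fun z hz => hz.1) fun z hz => ⟨hz, hcon z hz⟩
    rw [← hk, this] at hklt
    exact lt_irrefl _ hklt
  · rw [hk]
    by_cases hk1 : finrank K ↥(annihilator h ⊓ A 0) + 1 = finrank K (A 0)
    · exact Or.inl hk1
    -- In codimension two a jump α₂ ≥ α₁+2 would contradict `h0`, and both functionals are already
    -- independent on `A 0`, so `leftRadical_eq_inf` also applies with T = `A 0`.
    · have hk2 : finrank K ↥(annihilator h ⊓ A 0) + 2 = finrank K (A 0) := by omega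
      refine Or.inr ⟨?_, hk2, ?_⟩
      · by_contra hne
        exact hk1 (h0 (by omega))
      · rw [leftRadical_eq_inf hW hform hk2]

/-- The annihilator is ker φ ∩ ker ψ. The vectors x₀, y₀ show that φ and ψ are independent on `A 1`;
where the condition on `A 0` is imposed, ψ vanishes there and only φ cuts down the dimension. -/
theorem exists_isSchubertDecomposable_wedgeForm_eq (hm : 2 < m) (hA : Monotone A)
    {φ ψ : V →ₗ[K] K} {x₀ y₀ : V} (hx : x₀ ∈ A 0) (hy : y₀ ∈ A 1)
    (hφx : φ x₀ = 1) (hφy : φ y₀ = 0) (hψx : ψ x₀ = 0) (hψy : ψ y₀ = 1)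
    (hψ : finrank K (A 0) + 2 ≤ finrank K (A 1) → A 0 ≤ LinearMap.ker ψ) :
    ∃ h : ⋀[K]^(m - 2) V, IsSchubertDecomposable A h ∧
      ∀ x y, wedgeForm hm.le b h x y = φ x * ψ y - φ y * ψ x := by
  have := Module.Finite.of_basis b
  obtain ⟨h, hdec, hann, hform⟩ := exists_isDecomposable_wedgeForm_eq b hm hφx hφy hψx hψy
  refine ⟨h, ⟨hdec, fun i hi => ?_⟩, hform⟩
  rw [hann]
  have hone : (1 : K) ≠ 0 := one_ne_zero
  obtain rfl | rfl : i = 0 ∨ i = 1 := by omega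
  · obtain hi | ⟨_, hi⟩ := hi
    · simp at hi
    · have e : LinearMap.ker φ ⊓ LinearMap.ker ψ ⊓ A 0 = A 0 ⊓ LinearMap.ker φ := by
        rw [inf_assoc, inf_eq_right.2 (hψ hi), inf_comm]
      rw [e]
      exact finrank_inf_ker_add_one (A 0) φ hx (by rwa [hφx])
  · have e : LinearMap.ker φ ⊓ LinearMap.ker ψ ⊓ A 1 =
        A 1 ⊓ LinearMap.ker φ ⊓ LinearMap.ker ψ := by
      rw [inf_comm, inf_assoc]
    rw [e]
    have e1 := finrank_inf_ker_add_one (A 1) φ (hA (Fin.zero_le 1) hx) (by rwa [hφx])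
    have e2 := finrank_inf_ker_add_one (A 1 ⊓ LinearMap.ker φ) ψ (y := y₀) ⟨hy, hφy⟩
      (by rwa [hψy])
    change _ + (1 + 1) = _
    omega

/-- This shows that the lower bound for the weight is attained. -/
theorem exists_isSchubertDecomposable (b : Basis (Fin m) K V) (hm : 2 < m) (hA : StrictMono A) (hA0 : A 0 ≠ ⊥) :
    ∃ h : ⋀[K]^(m - 2) V, IsSchubertDecomposable A h := by
  obtain ⟨x₀, hx, hx0⟩ := Submodule.exists_mem_ne_zero_of_ne_bot hA0
  obtain ⟨y₀, hy, hy0⟩ := SetLike.exists_of_lt (hA Fin.zero_lt_one)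
  have key : ∀ (S : Submodule K V) (z : V), z ∉ S → ∃ g : V →ₗ[K] K, g z = 1 ∧ ∀ s ∈ S, g s = 0 := by
    intro S z hz
    obtain ⟨g, hg, hgS⟩ := Submodule.exists_le_ker_of_notMem hz
    exact ⟨(g z)⁻¹ • g, by simp [hg], fun s hs => by
      simp [LinearMap.mem_ker.1 (hgS hs)]⟩
  obtain ⟨ψ, hψy, hψ⟩ := key (A 0) y₀ hy0
  have hspan : x₀ ∉ Submodule.span K {y₀} := by
    intro hmem
    obtain ⟨r, rfl⟩ := Submodule.mem_span_singleton.1 hmem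
    have hr : r ≠ 0 := by rintro rfl; simp at hx0
    exact hy0 ((Submodule.smul_mem_iff _ hr).1 hx)
  obtain ⟨φ, hφx, hφ⟩ := key _ _ hspan
  obtain ⟨h, hh, -⟩ := exists_isSchubertDecomposable_wedgeForm_eq b hm hA.monotone hx hy hφx
    (hφ _ (Submodule.mem_span_singleton_self _)) (hψ _ hx) hψy (fun _ z hz => hψ z hz)
  exact ⟨h, hh⟩

/-- An element whose form has the radicals of a Schubert decomposable one agrees on `A₁ × A₂` with
the form of a Schubert decomposable element. -/
theorem exists_isSchubertDecomposable_of_finrank_leftRadical (hm : 2 < m) (hA : StrictMono A)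
    {B : V →ₗ[K] V →ₗ[K] K} (hB : ∀ x, B x x = 0) (hne : ∃ x ∈ A 0, ∃ y ∈ A 1, B x y ≠ 0)
    (hdim : finrank K (leftRadical B (A 0) (A 1)) + 1 = finrank K (A 0) ∨
        finrank K (A 1) = finrank K (A 0) + 1 ∧
          finrank K (leftRadical B (A 0) (A 1)) + 2 = finrank K (A 0) ∧
          finrank K (leftRadical B (A 0) (A 0)) = finrank K (leftRadical B (A 0) (A 1))) :
    ∃ h : ⋀[K]^(m - 2) V, IsSchubertDecomposable A h ∧
      ∀ x ∈ A 0, ∀ y ∈ A 1, wedgeForm hm.le b h x y = B x y := by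
  have := Module.Finite.of_basis b
  have h01 : A 0 < A 1 := hA Fin.zero_lt_one
  have hrle : leftRadical B (A 0) (A 1) ≤ A 0 := fun z hz => hz.1
  -- The functionals will be φ = B(·, y₀) and ψ = B(x₀, ·); the last condition makes their wedge
  -- agree with B on `A 0` × `A 1`.
  suffices H : ∃ x₀ ∈ A 0, ∃ y₀ ∈ A 1, B x₀ y₀ = 1 ∧
      (finrank K (A 0) + 2 ≤ finrank K (A 1) → A 0 ≤ LinearMap.ker (B x₀)) ∧
      A 0 ≤ leftRadical B (A 0) (A 1) ⊔ Submodule.span K {x₀, y₀} by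
    obtain ⟨x₀, hx, y₀, hy, h1, hker, hsup⟩ := H
    obtain ⟨h, hh, hform⟩ := exists_isSchubertDecomposable_wedgeForm_eq b hm hA.monotone
      (φ := B.flip y₀) (ψ := B x₀) hx hy h1 (hB y₀) (hB x₀) h1 hker
    refine ⟨h, hh, fun x hx' y hy' => ?_⟩
    rw [hform]
    exact (apply_eq_of_mem_sup (W := leftRadical B (A 0) (A 1)) hB h1
      (fun w hw => ⟨hw.2 _ (h01.le hx), hw.2 _ hy, hw.2 _ hy'⟩) (hsup hx')).symm
  have hscale : ∀ {S : Submodule K V} {x y : V}, y ∈ S → B x y ≠ 0 → ∃ y' ∈ S, B x y' = 1 := by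
    intro S x y hy hxy
    exact ⟨(B x y)⁻¹ • y, S.smul_mem _ hy, by simp [hxy]⟩
  obtain hk | ⟨hn, hk, ht⟩ := hdim
  · obtain ⟨x₀, hx, y, hy, hxy⟩ := hne
    obtain ⟨y₀, hy₀, h1⟩ := hscale hy hxy
    refine ⟨x₀, hx, y₀, hy₀, h1, fun _ z hz =>
      apply_eq_zero_of_finrank_leftRadical hB h01.le hk hx hz, ?_⟩
    -- The radical is a hyperplane of `A 0` missing x₀, so together they span `A 0`.
    have hlt : leftRadical B (A 0) (A 1) <
        leftRadical B (A 0) (A 1) ⊔ Submodule.span K {x₀} := by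
      refine lt_of_le_of_ne le_sup_left fun h => hxy ?_
      have : x₀ ∈ leftRadical B (A 0) (A 1) := by
        rw [h]
        exact Submodule.mem_sup_right (Submodule.mem_span_singleton_self _)
      exact this.2 y hy
    have hle : leftRadical B (A 0) (A 1) ⊔ Submodule.span K {x₀} ≤ A 0 :=
      sup_le hrle ((Submodule.span_singleton_le_iff_mem _ _).2 hx)
    have hlt' := Submodule.finrank_lt_finrank_of_lt hlt
    have heq := Submodule.eq_of_le_of_finrank_le hle (by omega)
    exact heq.ge.trans (sup_le_sup_left (Submodule.span_mono (by simp)) _)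
  · have hR : ∃ x ∈ A 0, ∃ y ∈ A 0, B x y ≠ 0 := by
      by_contra! hcon
      have : leftRadical B (A 0) (A 0) = A 0 :=
        le_antisymm (fun z hz => hz.1) fun z hz => ⟨hz, hcon z hz⟩
      rw [this] at ht
      omega
    obtain ⟨x₀, hx, y, hy, hxy⟩ := hR
    obtain ⟨y₀, hy₀, h1⟩ := hscale hy hxy
    refine ⟨x₀, hx, y₀, h01.le hy₀, h1, fun _ => by omega, ?_⟩
    have hspan : Submodule.span K {x₀, y₀} ≤ A 0 := by
      rw [Submodule.span_le]
      rintro z (rfl | rfl) <;> assumption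
    have hle : leftRadical B (A 0) (A 1) ⊔ Submodule.span K {x₀, y₀} ≤ A 0 := sup_le hrle hspan
    have hne1 : B x₀ y₀ ≠ 0 := by rw [h1]; exact one_ne_zero
    -- B is nondegenerate on ⟨x₀, y₀⟩, so this plane meets the radical trivially and, by dimensions,
    -- complements it in `A 0`.
    have hinf : leftRadical B (A 0) (A 1) ⊓ Submodule.span K {x₀, y₀} = ⊥ := by
      rw [eq_bot_iff, ← leftRadical_span_pair hB hne1 le_rfl]
      exact fun z hz => ⟨hz.2, fun w hw => hz.1.2 w (h01.le (hspan hw))⟩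
    have hfin := Submodule.finrank_sup_add_finrank_inf_eq (leftRadical B (A 0) (A 1))
      (Submodule.span K {x₀, y₀})
    rw [hinf, finrank_bot, finrank_span_pair_eq_two hB hne1] at hfin
    exact (Submodule.eq_of_le_of_finrank_le hle (by omega)).ge

end MinimumWeight

end SchubertCode

theorem corollary6p3 {K : Type*} [Field K] [Fintype K] [DecidableEq K]
    {V : Type*} [AddCommGroup V] [Module K V]
    {m : ℕ} (hm : 2 < m) (b : Module.Basis (Fin m) K V)
    (A : Fin 2 → Submodule K V) (hA : StrictMono A) (hA0 : ∀ i, A i ≠ ⊥)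
    {n : ℕ} (L : Fin n ≃ ↥(SchubertCode.schubertVariety A))
    (P : Fin n → ⋀[K]^2 V)
    (hP : ∀ j, SchubertCode.IsRepresentative A (L j : Submodule K V) (P j))
    (c : Fin n → K) :
    SchubertCode.IsMinWeightCodeword (SchubertCode.code hm.le b P) c ↔
      ∃ h : ⋀[K]^(m - 2) V,
        SchubertCode.IsSchubertDecomposable A h ∧ c = SchubertCode.codeword hm.le b P h := by
  open SchubertCode Module in
  have := Module.Finite.of_basis b
  set δ := finrank K (A 0) + finrank K (A 1) - 3
  have hB : ∀ f, ∀ x, wedgeForm hm.le b f x x = 0 := wedgeForm_self hm.le b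
  have hc : ∀ f : ⋀[K]^(m - 2) V, ∀ j, ∃ u v,
      Submodule.span K {u, v} = (L j : Submodule K V) ∧
        codeword hm.le b P f j = wedgeForm hm.le b f u v := by
    intro f j
    obtain ⟨v, -, hvL, hvP⟩ := hP j
    refine ⟨v 1, v 0, ?_, codeword_apply hm.le b P f j v hvP⟩
    rw [← hvL, Set.pair_comm]
    congr 1
    ext z
    simp [Fin.exists_fin_two, eq_comm]
  have hne : ∀ f : ⋀[K]^(m - 2) V, codeword hm.le b P f ≠ 0 →
      ∃ x ∈ A 0, ∃ y ∈ A 1, wedgeForm hm.le b f x y ≠ 0 := by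
    intro f hf
    by_contra! hcon
    apply hf
    rw [← map_zero (codeword hm.le b P)]
    refine codeword_congr hm.le b hP fun x hx y hy => ?_
    rw [neg_of_self_eq_zero (hB f) x y, hcon x hx y hy, wedgeForm_apply, map_zero, map_zero,
      neg_zero]
  have hmin : ∀ h : ⋀[K]^(m - 2) V, IsSchubertDecomposable A h →
      hammingNorm (codeword hm.le b P h) = Fintype.card K ^ δ := by
    intro h hh
    obtain ⟨h1, h2⟩ := hh.finrank_leftRadical b hm.le hA
    exact (pow_le_hammingNorm (hB h) hA L (hc h) h1).2.2 h2
  have hpos : 0 < Fintype.card K ^ δ := pow_pos Fintype.card_pos _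
  constructor
  · rintro ⟨⟨f, rfl⟩, ⟨x, -, hx0, hx⟩, hleast⟩
    have hf : codeword hm.le b P f ≠ 0 := by
      rw [← hammingNorm_ne_zero_iff, ← hx, hammingNorm_ne_zero_iff]
      exact hx0
    -- Comparison with c_{h₀} bounds the minimum weight above by q^δ, so the equality case of
    -- `pow_le_hammingNorm` applies to f.
    obtain ⟨h₀, hh₀⟩ := exists_isSchubertDecomposable b hm hA (hA0 0)
    have hle : hammingNorm (codeword hm.le b P f) ≤ Fintype.card K ^ δ := by
      rw [← hmin h₀ hh₀]
      refine hleast ⟨_, ⟨h₀, rfl⟩, ?_, rfl⟩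
      rw [← hammingNorm_ne_zero_iff, hmin h₀ hh₀]
      exact hpos.ne'
    obtain ⟨h1, h2⟩ := pow_le_hammingNorm (hB f) hA L (hc f) (hne f hf)
    obtain ⟨h, hh, hform⟩ := exists_isSchubertDecomposable_of_finrank_leftRadical b hm hA (hB f)
      (hne f hf) (h2.1 (le_antisymm hle h1))
    refine ⟨h, hh, codeword_congr hm.le b hP fun x hx y hy => ?_⟩
    rw [neg_of_self_eq_zero (hB f) x y, neg_of_self_eq_zero (hB h) x y, hform x hx y hy]
  · rintro ⟨h, hh, rfl⟩
    refine ⟨⟨h, rfl⟩, ⟨_, ⟨h, rfl⟩, ?_, rfl⟩, ?_⟩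
    · rw [← hammingNorm_ne_zero_iff, hmin h hh]
      exact hpos.ne'
    · rintro _ ⟨_, ⟨f, rfl⟩, hf, rfl⟩
      rw [hmin h hh]
      exact (pow_le_hammingNorm (hB f) hA L (hc f) (hne f hf)).1
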